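/- Let $k$ and $g$ be nonnegative integers with $k\ge 2$ and $g$ even. There exist a finite simple bipartite graph $H_k$ and a $k$-list assignment $L$ on $H_k$ (that is, a set $L(v)$ of exactly $k$ colors for each vertex $v$) such that (i) $H_k$ has girth at least $g$, i.e. every cycle of $H_k$ has length at least $g$; (ii) every proper subgraph $F$ of $H_k$ (any subgraph with at least one vertex, other than $H_k$ itself) has average degree $\frac{1}{|V(F)|}\sum_{v\in V(F)} d_F(v)\le 2(k-1)$; (iii) $\bigl|\bigcup_{v\in V(H_k)}L(v)\bigr|=2k-1$; and (iv) $H_k$ is not $L$-colorable, i.e. there is no proper coloring $f$ of $H_k$ with $f(v)\in L(v)$ for all $v\in V(H_k)$. -/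

import Mathlib

/-- The average degree `(∑ v ∈ V(F), d_F(v)) / |V(F)|` of a subgraph `F` of a finite graph
(the value for the subgraph without vertices is `0`). -/
noncomputable def SimpleGraph.Subgraph.averageDegree {V : Type*} [Fintype V] {G : SimpleGraph V}
    (F : G.Subgraph) : ℚ := by
  classical
  exact (∑ v : F.verts, (F.degree (v : V) : ℚ)) / (Fintype.card F.verts : ℚ)

/-- A `k`-list assignment: every vertex receives a list (a finite set) of exactly `k` colors. -/
def IsListAssignment {V C : Type*} (k : ℕ) (L : V → Finset C) : Prop :=
  ∀ v, (L v).card = k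

/-- `G` is `L`-colorable: there is a proper coloring `f` of `G` with `f v ∈ L v` for all `v`. -/
def SimpleGraph.ListColorable {V C : Type*} (G : SimpleGraph V) (L : V → Finset C) : Prop :=
  ∃ f : G.Coloring C, ∀ v, f v ∈ L v

/-! The graph joins variables to the clauses containing them; the list of a clause is the set of
values it forbids. If a decision tree ends every branch at a clause violated along that branch,
every choice of colors for the variables violates some clause, and then each color in that clause's
list is already used by a neighbor (`EssentialTree.not_listColorable`).

Density: the tree is pruned (`Tree.exists_essentialTree`) so that it has (k-1)|A|+1 clauses on its
variable set A, while every nonempty set Z of its variables meets at least (k-1)|Z|+1 of them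
(`EssentialTree.card_touching`). Hence a proper subgraph with p variables has at most (k-1)p clauses
keeping all k edges. The other clauses keep at most k-1, so there are at most k-1 edges per vertex.

Girth and lists: hanging systems below the clauses of another system lengthens each clause by one
variable and, if the new links are injective, allows an induction on girth (`Sparse.compose`,
`exists_uniform`). A pigeonhole choice of what to hang makes the values within a clause distinct
(`exists_rainbow`), using 2k-1 colors; fewer never suffice, by `listColorable_of_card_biUnion_lt`.
-/

/-- A finite family of clauses indexed by `Y` over variables `X` with values in `ℕ`: the clause `y`
forbids the assignments `f` with `f x = val y x` for all `x ∈ vars y`. The variable `x` takes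
values in `list x`. -/
structure ClauseSystem where
  X : Type
  Y : Type
  decX : DecidableEq X
  decY : DecidableEq Y
  finY : Fintype Y
  vars : Y → Finset X
  val : Y → X → ℕ
  list : X → Finset ℕ

/-! ### Decision trees: pruning and counting -/

namespace ClauseSystem

attribute [instance] decX decY finY

/-- `F.Tree k σ A B`: a decision tree, all of whose internal nodes query distinct variables (the
set `A`) with `k` possible values, and whose leaves are labelled by distinct clauses (the set `B`).
Each leaf clause is violated by the assignments along its branch, starting from `σ`. -/
inductive Tree (F : ClauseSystem) (k : ℕ) : Set (F.X × ℕ) → Finset F.X → Finset F.Y → Prop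
  | leaf (σ : Set (F.X × ℕ)) (y : F.Y) (h : ∀ x ∈ F.vars y, (x, F.val y x) ∈ σ) :
      Tree F k σ ∅ {y}
  | node (σ : Set (F.X × ℕ)) (x : F.X) (A : ℕ → Finset F.X) (B : ℕ → Finset F.Y)
      (hk : (F.list x).card = k)
      (hx : ∀ c ∈ F.list x, x ∉ A c)
      (hA : (F.list x : Set ℕ).PairwiseDisjoint A)
      (hB : (F.list x : Set ℕ).PairwiseDisjoint B)
      (h : ∀ c ∈ F.list x, Tree F k (insert (x, c) σ) (A c) (B c)) :
      Tree F k σ (insert x ((F.list x).biUnion A)) ((F.list x).biUnion B)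

/-- A decision tree in which, below every child of an internal node, some leaf clause contains the
variable queried at that node. -/
inductive EssentialTree (F : ClauseSystem) (k : ℕ) :
    Set (F.X × ℕ) → Finset F.X → Finset F.Y → Prop
  | leaf (σ : Set (F.X × ℕ)) (y : F.Y) (h : ∀ x ∈ F.vars y, (x, F.val y x) ∈ σ) :
      EssentialTree F k σ ∅ {y}
  | node (σ : Set (F.X × ℕ)) (x : F.X) (A : ℕ → Finset F.X) (B : ℕ → Finset F.Y)
      (hk : (F.list x).card = k)
      (hx : ∀ c ∈ F.list x, x ∉ A c)
      (hA : (F.list x : Set ℕ).PairwiseDisjoint A)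
      (hB : (F.list x : Set ℕ).PairwiseDisjoint B)
      (hu : ∀ c ∈ F.list x, ∃ y ∈ B c, x ∈ F.vars y)
      (h : ∀ c ∈ F.list x, EssentialTree F k (insert (x, c) σ) (A c) (B c)) :
      EssentialTree F k σ (insert x ((F.list x).biUnion A)) ((F.list x).biUnion B)

variable {F : ClauseSystem} {k : ℕ}

/-- A leaf consults the path only at variables of its own clause, so entries that no clause uses may
be dropped. -/
theorem EssentialTree.weaken {τ : Set (F.X × ℕ)} {A : Finset F.X} {B : Finset F.Y}
    (hT : F.EssentialTree k τ A B) : ∀ σ : Set (F.X × ℕ),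
    (∀ y ∈ B, ∀ x ∈ F.vars y, (x, F.val y x) ∈ τ → (x, F.val y x) ∈ σ) →
    F.EssentialTree k σ A B := by
  induction hT with
  | leaf τ y h =>
    intro σ hσ
    exact .leaf σ y fun x hx => hσ y (by simp) x hx (h x hx)
  | node τ x A B hk hx hA hB hu h ih =>
    intro σ hσ
    refine .node σ x A B hk hx hA hB hu fun c hc => ih c hc _ fun y hy z hz hm => ?_
    rcases hm with hm | hm
    · exact Or.inl hm
    · exact Or.inr (hσ y (Finset.mem_biUnion.2 ⟨c, hc, hy⟩) z hz hm)

/-- Pruning: if no clause below some child mentions the queried variable, the answer is never used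
there, and that child's subtree can replace the whole node. -/
theorem Tree.exists_essentialTree {σ : Set (F.X × ℕ)} {A : Finset F.X} {B : Finset F.Y}
    (hT : F.Tree k σ A B) : ∃ A' ⊆ A, ∃ B' ⊆ B, F.EssentialTree k σ A' B' := by
  induction hT with
  | leaf σ y h => exact ⟨∅, by simp, {y}, by simp, .leaf σ y h⟩
  | node σ x A B hk hx hA hB h ih =>
    have ih' : ∀ c, ∃ A' B', c ∈ F.list x →
        A' ⊆ A c ∧ B' ⊆ B c ∧ F.EssentialTree k (insert (x, c) σ) A' B' := by
      intro c
      by_cases hc : c ∈ F.list x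
      · obtain ⟨A', h1, B', h2, h3⟩ := ih c hc
        exact ⟨A', B', fun _ => ⟨h1, h2, h3⟩⟩
      · exact ⟨∅, ∅, fun h => absurd h hc⟩
    choose A' B' h' using ih'
    by_cases hu : ∀ c ∈ F.list x, ∃ y ∈ B' c, x ∈ F.vars y
    · refine ⟨insert x ((F.list x).biUnion A'), ?_, (F.list x).biUnion B', ?_,
        .node σ x A' B' hk (fun c hc hm => hx c hc ((h' c hc).1 hm))
          (fun c hc d hd hcd => (hA hc hd hcd).mono (h' c hc).1 (h' d hd).1)
          (fun c hc d hd hcd => (hB hc hd hcd).mono (h' c hc).2.1 (h' d hd).2.1) hu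
          fun c hc => (h' c hc).2.2⟩
      · exact Finset.insert_subset_insert _ (Finset.biUnion_mono fun c hc => (h' c hc).1)
      · exact Finset.biUnion_mono fun c hc => (h' c hc).2.1
    · push Not at hu
      obtain ⟨c, hc, hu⟩ := hu
      refine ⟨A' c, ((h' c hc).1.trans (Finset.subset_biUnion_of_mem A hc)).trans
        (Finset.subset_insert _ _), B' c, (h' c hc).2.1.trans (Finset.subset_biUnion_of_mem B hc),
        (h' c hc).2.2.weaken σ fun y hy z hz hm => ?_⟩
      rcases hm with hm | hm
      · obtain ⟨rfl, -⟩ := Prod.mk.inj hm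
        exact absurd hz (hu y hy)
      · exact hm

theorem EssentialTree.list_card {σ : Set (F.X × ℕ)} {A : Finset F.X} {B : Finset F.Y}
    (hT : F.EssentialTree k σ A B) : ∀ x ∈ A, (F.list x).card = k := by
  induction hT with
  | leaf σ y h => simp
  | node σ x A B hk hx hA hB hu h ih =>
    intro z hz
    rcases Finset.mem_insert.1 hz with rfl | hz
    · exact hk
    · obtain ⟨c, hc, hz⟩ := Finset.mem_biUnion.1 hz
      exact ih c hc z hz

theorem EssentialTree.mem_of_mem_vars {σ : Set (F.X × ℕ)} {A : Finset F.X} {B : Finset F.Y}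
    (hT : F.EssentialTree k σ A B) :
    ∀ y ∈ B, ∀ x ∈ F.vars y, x ∈ A ∨ (x, F.val y x) ∈ σ := by
  induction hT with
  | leaf σ y h =>
    intro y' hy x hx
    obtain rfl := Finset.mem_singleton.1 hy
    exact Or.inr (h x hx)
  | node σ x A B hk hx hA hB hu h ih =>
    intro y hy z hz
    obtain ⟨c, hc, hy⟩ := Finset.mem_biUnion.1 hy
    rcases ih c hc y hy z hz with h1 | h1 | h1
    · exact Or.inl (Finset.mem_insert_of_mem (Finset.mem_biUnion.2 ⟨c, hc, h1⟩))
    · obtain ⟨rfl, -⟩ := Prod.mk.inj h1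
      exact Or.inl (Finset.mem_insert_self _ _)
    · exact Or.inr h1

theorem EssentialTree.exists_violated {σ : Set (F.X × ℕ)} {A : Finset F.X} {B : Finset F.Y}
    (hT : F.EssentialTree k σ A B) (f : F.X → ℕ) (hf : ∀ x ∈ A, f x ∈ F.list x)
    (hσ : ∀ p ∈ σ, f p.1 = p.2) : ∃ y ∈ B, ∀ x ∈ F.vars y, f x = F.val y x := by
  induction hT with
  | leaf σ y h => exact ⟨y, by simp, fun x hx => hσ _ (h x hx)⟩
  | node σ x A B hk hx hA hB hu h ih =>
    have hc := hf x (Finset.mem_insert_self _ _)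
    obtain ⟨y, hy, hv⟩ := ih (f x) hc
      (fun z hz => hf z (Finset.mem_insert_of_mem (Finset.mem_biUnion.2 ⟨_, hc, hz⟩)))
      (by rintro p (rfl | hp)
          · rfl
          · exact hσ p hp)
    exact ⟨y, Finset.mem_biUnion.2 ⟨_, hc, hy⟩, hv⟩

/-- Each query replaces one open branch by k, a gain of k-1. -/
theorem EssentialTree.card_leaves {σ : Set (F.X × ℕ)} {A : Finset F.X} {B : Finset F.Y}
    (hk : 1 ≤ k) (hT : F.EssentialTree k σ A B) : B.card = (k - 1) * A.card + 1 := by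
  induction hT with
  | leaf σ y h => simp
  | node σ x A B hk' hx hA hB hu h ih =>
    rw [Finset.card_insert_of_notMem (by simpa using hx), Finset.card_biUnion hA,
      Finset.card_biUnion hB, Finset.sum_congr rfl ih, Finset.sum_add_distrib, ← Finset.mul_sum]
    simp only [Finset.sum_const, hk', smul_eq_mul, mul_one, mul_add]
    omega

/-- The bounds for the children are added. If the root is in Z, all k children contribute a surplus
of 1, which pays k-1 for the root and leaves 1; otherwise a single child meeting Z gives the
surplus. -/
theorem EssentialTree.card_touching {σ : Set (F.X × ℕ)} {A : Finset F.X} {B : Finset F.Y}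
    (hk : 1 ≤ k) (hT : F.EssentialTree k σ A B) : ∀ Z ⊆ A, Z.Nonempty →
    (k - 1) * Z.card + 1 ≤ (B.filter fun y => ∃ z ∈ Z, z ∈ F.vars y).card := by
  induction hT with
  | leaf σ y h =>
    intro Z hZ hne
    exact absurd (Finset.subset_empty.1 hZ) hne.ne_empty
  | node σ x A B hk' hx hA hB hu h ih =>
    intro Z hZ hne
    have hcard : Z.card ≤ (if x ∈ Z then 1 else 0) + ∑ c ∈ F.list x, (Z ∩ A c).card := by
      have h1 : Z ⊆ (if x ∈ Z then {x} else ∅) ∪ (F.list x).biUnion fun c => Z ∩ A c := by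
        intro z hz
        rcases Finset.mem_insert.1 (hZ hz) with rfl | h2
        · simp [hz]
        · obtain ⟨c, hc, h2⟩ := Finset.mem_biUnion.1 h2
          exact Finset.mem_union_right _ (Finset.mem_biUnion.2 ⟨c, hc, Finset.mem_inter.2 ⟨hz, h2⟩⟩)
      refine (Finset.card_le_card h1).trans ((Finset.card_union_le _ _).trans
        (add_le_add ?_ Finset.card_biUnion_le))
      split_ifs <;> simp
    rw [Finset.filter_biUnion, Finset.card_biUnion fun c hc d hd hcd =>
      (hB hc hd hcd).mono (Finset.filter_subset _ _) (Finset.filter_subset _ _)]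
    have hstep : ∀ c ∈ F.list x, (Z ∩ A c).Nonempty → (k - 1) * (Z ∩ A c).card + 1 ≤
        ((B c).filter fun y => ∃ z ∈ Z, z ∈ F.vars y).card := fun c hc hn =>
      (ih c hc _ Finset.inter_subset_right hn).trans (Finset.card_le_card
        (Finset.monotone_filter_right _ fun y _ ⟨z, hz, hzy⟩ => ⟨z, (Finset.mem_inter.1 hz).1, hzy⟩))
    by_cases hxZ : x ∈ Z
    · have hstep' : ∀ c ∈ F.list x, (k - 1) * (Z ∩ A c).card + 1 ≤
          ((B c).filter fun y => ∃ z ∈ Z, z ∈ F.vars y).card := by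
        intro c hc
        by_cases hn : (Z ∩ A c).Nonempty
        · exact hstep c hc hn
        -- A child whose variables miss Z still has a clause containing the root: this is what
        -- pruning secures.
        · obtain ⟨y, hy, hxy⟩ := hu c hc
          rw [Finset.not_nonempty_iff_eq_empty.1 hn]
          simpa using Finset.card_pos.2 ⟨y, Finset.mem_filter.2 ⟨hy, x, hxZ, hxy⟩⟩
      have h2 := Finset.sum_le_sum hstep'
      rw [Finset.sum_add_distrib, ← Finset.mul_sum, Finset.sum_const, hk', smul_eq_mul,
        mul_one] at h2
      rw [if_pos hxZ] at hcard
      have h3 := Nat.mul_le_mul_left (k - 1) hcard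
      rw [mul_add, mul_one] at h3
      omega
    · obtain ⟨z, hz⟩ := hne
      have hz' : z ∈ (F.list x).biUnion A := by
        rcases Finset.mem_insert.1 (hZ hz) with rfl | h2
        · exact absurd hz hxZ
        · exact h2
      obtain ⟨c₀, hc₀, hz'⟩ := Finset.mem_biUnion.1 hz'
      rw [if_neg hxZ, zero_add] at hcard
      have h2 : ∑ c ∈ F.list x, (k - 1) * (Z ∩ A c).card <
          ∑ c ∈ F.list x, ((B c).filter fun y => ∃ z ∈ Z, z ∈ F.vars y).card := by
        refine Finset.sum_lt_sum (fun c hc => ?_)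
          ⟨c₀, hc₀, hstep c₀ hc₀ ⟨z, Finset.mem_inter.2 ⟨hz, hz'⟩⟩⟩
        by_cases hn : (Z ∩ A c).Nonempty
        · exact (Nat.le_succ _).trans (hstep c hc hn)
        · simp [Finset.not_nonempty_iff_eq_empty.1 hn]
      rw [← Finset.mul_sum] at h2
      exact (Nat.mul_le_mul_left (k - 1) hcard).trans_lt h2

/-! ### Girth without walks -/

/-- Every nonempty finite subgraph of minimum degree at least two of the incidence graph between
variables and clauses meets at least `m` clauses. Equivalently, the incidence graph has girth at
least `2 * m`. -/
def Sparse (F : ClauseSystem) (m : ℕ) : Prop :=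
  ∀ E : Finset (F.X × F.Y), E.Nonempty → (∀ x y, (x, y) ∈ E → x ∈ F.vars y) →
    (∀ x y, (x, y) ∈ E → ∃ y', y' ≠ y ∧ (x, y') ∈ E) →
    (∀ x y, (x, y) ∈ E → ∃ x', x' ≠ x ∧ (x', y) ∈ E) →
    m ≤ (E.image Prod.snd).card

theorem Sparse.mono {F : ClauseSystem} {m n : ℕ} (h : F.Sparse m) (hn : n ≤ m) : F.Sparse n :=
  fun E h1 h2 h3 h4 => hn.trans (h E h1 h2 h3 h4)

/-- One vertex of degree one is harmless: delete its edge, and the only vertex that can become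
deficient is the other endpoint, on the opposite side. This alternation is why both statements are
proved in one induction on the number of edges. -/
theorem Sparse.le_card_of_exceptional {F : ClauseSystem} {m : ℕ} (hF : F.Sparse m) (n : ℕ) :
    ∀ E : Finset (F.X × F.Y), E.card = n → E.Nonempty → (∀ x y, (x, y) ∈ E → x ∈ F.vars y) →
    ((∀ x y, (x, y) ∈ E → ∃ y', y' ≠ y ∧ (x, y') ∈ E) →
      (∀ y₀, (∀ x y, (x, y) ∈ E → y ≠ y₀ → ∃ x', x' ≠ x ∧ (x', y) ∈ E) →
        m ≤ (E.image Prod.snd).card)) ∧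
    ((∀ x y, (x, y) ∈ E → ∃ x', x' ≠ x ∧ (x', y) ∈ E) →
      (∀ x₀, (∀ x y, (x, y) ∈ E → x ≠ x₀ → ∃ y', y' ≠ y ∧ (x, y') ∈ E) →
        m ≤ (E.image Prod.snd).card)) := by
  induction n with
  | zero =>
    intro E hE hne
    exact absurd (Finset.card_eq_zero.1 hE) hne.ne_empty
  | succ n ih =>
    intro E hE hne hv
    constructor
    · intro hX y₀ hY
      by_cases hc : ∀ x y, (x, y) ∈ E → ∃ x', x' ≠ x ∧ (x', y) ∈ E
      · exact hF E hne hv hX hc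
      push Not at hc
      obtain ⟨x, y, hxy, hc⟩ := hc
      have hy : y = y₀ := by
        by_contra hy
        obtain ⟨x', h1, h2⟩ := hY x y hxy hy
        exact hc x' h1 h2
      subst hy
      obtain ⟨y', h1, h2⟩ := hX x y hxy
      have hmem : ∀ a b, (a, b) ∈ E.erase (x, y) → b ≠ y ∧ (a, b) ∈ E := by
        intro a b hab
        obtain ⟨h3, h4⟩ := Finset.mem_erase.1 hab
        refine ⟨?_, h4⟩
        rintro rfl
        exact hc a (fun h => h3 (by rw [h])) h4
      refine le_trans ((ih (E.erase (x, y)) (by rw [Finset.card_erase_of_mem hxy, hE]; rfl)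
        ⟨(x, y'), Finset.mem_erase.2 ⟨by simp [h1], h2⟩⟩
        (fun a b hab => hv a b (hmem a b hab).2)).2 ?_ x ?_)
        (Finset.card_le_card (Finset.image_subset_image (Finset.erase_subset _ _)))
      · intro a b hab
        obtain ⟨h3, h4⟩ := hmem a b hab
        obtain ⟨a', h5, h6⟩ := hY a b h4 h3
        exact ⟨a', h5, Finset.mem_erase.2 ⟨by simp [h3], h6⟩⟩
      · intro a b hab hax
        obtain ⟨h3, h4⟩ := hmem a b hab
        obtain ⟨b', h5, h6⟩ := hX a b h4
        exact ⟨b', h5, Finset.mem_erase.2 ⟨by simp [hax], h6⟩⟩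
    · intro hY x₀ hX
      by_cases hc : ∀ x y, (x, y) ∈ E → ∃ y', y' ≠ y ∧ (x, y') ∈ E
      · exact hF E hne hv hc hY
      push Not at hc
      obtain ⟨x, y, hxy, hc⟩ := hc
      have hx : x = x₀ := by
        by_contra hx
        obtain ⟨y', h1, h2⟩ := hX x y hxy hx
        exact hc y' h1 h2
      subst hx
      obtain ⟨x', h1, h2⟩ := hY x y hxy
      have hmem : ∀ a b, (a, b) ∈ E.erase (x, y) → a ≠ x ∧ (a, b) ∈ E := by
        intro a b hab
        obtain ⟨h3, h4⟩ := Finset.mem_erase.1 hab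
        refine ⟨?_, h4⟩
        rintro rfl
        exact hc b (fun h => h3 (by rw [h])) h4
      refine le_trans ((ih (E.erase (x, y)) (by rw [Finset.card_erase_of_mem hxy, hE]; rfl)
        ⟨(x', y), Finset.mem_erase.2 ⟨by simp [h1], h2⟩⟩
        (fun a b hab => hv a b (hmem a b hab).2)).1 ?_ y ?_)
        (Finset.card_le_card (Finset.image_subset_image (Finset.erase_subset _ _)))
      · intro a b hab
        obtain ⟨h3, h4⟩ := hmem a b hab
        obtain ⟨b', h5, h6⟩ := hX a b h4 h3
        exact ⟨b', h5, Finset.mem_erase.2 ⟨by simp [h3], h6⟩⟩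
      · intro a b hab hby
        obtain ⟨h3, h4⟩ := hmem a b hab
        obtain ⟨a', h5, h6⟩ := hY a b h4
        exact ⟨a', h5, Finset.mem_erase.2 ⟨by simp [hby], h6⟩⟩

/-! ### Composition of systems -/

/-- Hang the system `T y` below the clause `y` of `F`; the clause `z` of `T y` is extended by the
variable `ι y z` of `F`, with the value prescribed by `y`. -/
abbrev compose (F : ClauseSystem) (T : F.Y → ClauseSystem) (ι : ∀ y, (T y).Y → F.X) :
    ClauseSystem where
  X := F.X ⊕ Σ y, (T y).X
  Y := Σ y, (T y).Y
  decX := inferInstance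
  decY := inferInstance
  finY := inferInstance
  vars p := ({ι p.1 p.2} : Finset F.X).disjSum
    (((T p.1).vars p.2).map (Function.Embedding.sigmaMk p.1))
  val p := Sum.elim (F.val p.1)
    fun q => if h : q.1 = p.1 then (T p.1).val p.2 (h ▸ q.2) else 0
  list := Sum.elim F.list fun q => (T q.1).list q.2

section compose

variable {F : ClauseSystem} {T : F.Y → ClauseSystem} {ι : ∀ y, (T y).Y → F.X} {k : ℕ}

theorem inl_mem_compose_vars {y : F.Y} {z : (T y).Y} {a : F.X} :
    (Sum.inl a : (F.compose T ι).X) ∈ (F.compose T ι).vars ⟨y, z⟩ ↔ a = ι y z :=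
  Finset.inl_mem_disjSum.trans Finset.mem_singleton

theorem inr_mem_compose_vars {y y' : F.Y} {z : (T y).Y} {x : (T y').X} :
    (Sum.inr ⟨y', x⟩ : (F.compose T ι).X) ∈ (F.compose T ι).vars ⟨y, z⟩ ↔
      ∃ x' ∈ (T y).vars z, (⟨y, x'⟩ : Σ y, (T y).X) = ⟨y', x⟩ :=
  Finset.inr_mem_disjSum.trans Finset.mem_map

theorem inr_mem_compose_vars_self {y : F.Y} {z : (T y).Y} {x : (T y).X} :
    (Sum.inr ⟨y, x⟩ : (F.compose T ι).X) ∈ (F.compose T ι).vars ⟨y, z⟩ ↔ x ∈ (T y).vars z := by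
  rw [inr_mem_compose_vars]
  constructor
  · rintro ⟨x', h, h'⟩
    cases h'
    exact h
  · exact fun h => ⟨x, h, rfl⟩

theorem fst_eq_of_inr_mem_compose_vars {y y' : F.Y} {z : (T y).Y} {x : (T y').X}
    (h : (Sum.inr ⟨y', x⟩ : (F.compose T ι).X) ∈ (F.compose T ι).vars ⟨y, z⟩) : y = y' := by
  obtain ⟨x', -, h'⟩ := inr_mem_compose_vars.1 h
  exact (Sigma.mk.inj h').1

theorem compose_val_inr {y : F.Y} {z : (T y).Y} {x : (T y).X} :
    (F.compose T ι).val ⟨y, z⟩ (Sum.inr ⟨y, x⟩) = (T y).val z x :=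
  dif_pos rfl

theorem forall_mem_compose_vars {y : F.Y} {z : (T y).Y} {P : (F.compose T ι).X → Prop} :
    (∀ x ∈ (F.compose T ι).vars ⟨y, z⟩, P x) ↔
      P (Sum.inl (ι y z)) ∧ ∀ x ∈ (T y).vars z, P (Sum.inr ⟨y, x⟩) := by
  constructor
  · exact fun h => ⟨h _ (inl_mem_compose_vars.2 rfl),
      fun x hx => h _ (inr_mem_compose_vars_self.2 hx)⟩
  · rintro ⟨h1, h2⟩ (a | ⟨y', x⟩) hx
    · rw [inl_mem_compose_vars.1 hx]
      exact h1
    · obtain rfl := fst_eq_of_inr_mem_compose_vars hx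
      exact h2 x (inr_mem_compose_vars_self.1 hx)

theorem card_compose_vars {y : F.Y} {z : (T y).Y} :
    ((F.compose T ι).vars ⟨y, z⟩).card = ((T y).vars z).card + 1 := by
  refine (Finset.card_disjSum _ _).trans ?_
  rw [Finset.card_singleton, Finset.card_map, add_comm]

theorem image_compose_vars {y : F.Y} {z : (T y).Y} :
    ((F.compose T ι).vars ⟨y, z⟩).image ((F.compose T ι).val ⟨y, z⟩) =
      insert (F.val y (ι y z)) (((T y).vars z).image ((T y).val z)) := by
  ext c
  simp only [Finset.mem_image, Finset.mem_insert]
  constructor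
  · rintro ⟨x, hx, rfl⟩
    revert x
    rw [forall_mem_compose_vars]
    exact ⟨Or.inl rfl, fun x hx => Or.inr ⟨x, hx, (compose_val_inr (ι := ι)).symm⟩⟩
  · rintro (rfl | ⟨x, hx, rfl⟩)
    · exact ⟨_, inl_mem_compose_vars.2 rfl, rfl⟩
    · exact ⟨_, inr_mem_compose_vars_self.2 hx, compose_val_inr (ι := ι)⟩

theorem Tree.congr {F : ClauseSystem} {σ : Set (F.X × ℕ)} {A A' : Finset F.X} {B B' : Finset F.Y}
    (hT : F.Tree k σ A B) (hA : A' = A) (hB : B' = B) : F.Tree k σ A' B' := by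
  rwa [hA, hB]

theorem Tree.inr {y : F.Y} {τ : Set ((T y).X × ℕ)} {A : Finset (T y).X} {B : Finset (T y).Y}
    (hT : (T y).Tree k τ A B) : ∀ σ : Set ((F.compose T ι).X × ℕ),
    (∀ z, (Sum.inl (ι y z), F.val y (ι y z)) ∈ σ) →
    (∀ x c, (x, c) ∈ τ → (Sum.inr ⟨y, x⟩, c) ∈ σ) →
    (F.compose T ι).Tree k σ
      (A.image fun x => Sum.inr ⟨y, x⟩) (B.image fun z => ⟨y, z⟩) := by
  induction hT with
  | leaf τ z h =>
    intro σ h1 h2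
    rw [Finset.image_empty, Finset.image_singleton]
    refine .leaf (F := F.compose T ι) σ ⟨y, z⟩ (forall_mem_compose_vars.2 ⟨h1 z, fun x hx => ?_⟩)
    rw [compose_val_inr]
    exact h2 _ _ (h x hx)
  | node τ x A B hk hx hA hB h ih =>
    intro σ h1 h2
    rw [Finset.image_insert, Finset.biUnion_image, Finset.biUnion_image]
    have hi : Function.Injective fun x : (T y).X => (Sum.inr ⟨y, x⟩ : (F.compose T ι).X) :=
      Sum.inr_injective.comp sigma_mk_injective
    refine .node (F := F.compose T ι) σ (Sum.inr ⟨y, x⟩)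
      (fun c => (A c).image fun x => Sum.inr ⟨y, x⟩) (fun c => (B c).image fun z => ⟨y, z⟩)
      hk ?_ ?_ ?_ ?_
    · intro c hc hm
      obtain ⟨x', h3, h4⟩ := Finset.mem_image.1 hm
      rw [hi h4] at h3
      exact hx c hc h3
    · exact fun c hc d hd hcd => (Finset.disjoint_image hi).2 (hA hc hd hcd)
    · exact fun c hc d hd hcd => (Finset.disjoint_image sigma_mk_injective).2 (hB hc hd hcd)
    · refine fun c hc => ih c hc _ (fun z => Or.inr (h1 z)) fun x' c' hm => ?_
      rcases hm with hm | hm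
      · cases hm
        exact Or.inl rfl
      · exact Or.inr (h2 _ _ hm)

/-- A branch ending at the clause y has given all its variables the forbidden values, in particular
each added variable `ι y z`. The tree of `T y` can therefore be continued from that leaf. -/
theorem Tree.compose (hι : ∀ y z, ι y z ∈ F.vars y) {A' : ∀ y, Finset (T y).X}
    (hT' : ∀ y, (T y).Tree k ∅ (A' y) Finset.univ)
    {τ : Set (F.X × ℕ)} {A : Finset F.X} {B : Finset F.Y}
    (hT : F.Tree k τ A B) : ∀ σ : Set ((F.compose T ι).X × ℕ),
    (∀ x c, (x, c) ∈ τ → (Sum.inl x, c) ∈ σ) →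
    (F.compose T ι).Tree k σ (A.disjSum (B.sigma A')) (B.sigma fun _ => Finset.univ) := by
  induction hT with
  | leaf τ y h =>
    intro σ h1
    have h2 := (hT' y).inr (ι := ι) σ (fun z => h1 _ _ (h _ (hι y z))) (by simp)
    refine h2.congr ?_ ?_
    · ext (a | ⟨y', x⟩)
      · simp
      · simp only [Finset.inr_mem_disjSum, Finset.mem_sigma, Finset.mem_singleton,
          Finset.mem_image]
        constructor
        · rintro ⟨rfl, hx⟩
          exact ⟨x, hx, rfl⟩
        · rintro ⟨x', hx', h3⟩
          cases h3
          exact ⟨rfl, hx'⟩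
    · ext ⟨y', z⟩
      simp only [Finset.mem_sigma, Finset.mem_singleton, Finset.mem_image, Finset.mem_univ,
        and_true, true_and]
      constructor
      · rintro rfl
        exact ⟨z, rfl⟩
      · rintro ⟨z', h3⟩
        cases h3
        rfl
  | node τ x A B hk hx hA hB h ih =>
    intro σ h1
    have h2 : (F.compose T ι).Tree k σ _ _ := .node (F := F.compose T ι) σ (Sum.inl x)
      (fun c => (A c).disjSum ((B c).sigma A')) (fun c => (B c).sigma fun _ => Finset.univ)
      hk ?_ ?_ ?_ ?_
    · refine h2.congr ?_ ?_
      · ext (a | ⟨y', x'⟩)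
        · rw [Finset.inl_mem_disjSum, Finset.mem_insert, Finset.mem_insert]
          refine or_congr ⟨fun h => h ▸ rfl, fun h => Sum.inl_injective h⟩ ?_
          rw [Finset.mem_biUnion, Finset.mem_biUnion]
          exact exists_congr fun c => and_congr_right fun _ => Finset.inl_mem_disjSum.symm
        · rw [Finset.inr_mem_disjSum, Finset.mem_insert, Finset.mem_sigma, Finset.mem_biUnion,
            Finset.mem_biUnion]
          constructor
          · rintro ⟨⟨c, hc, h3⟩, h4⟩
            exact Or.inr ⟨c, hc, Finset.inr_mem_disjSum.2 (Finset.mem_sigma.2 ⟨h3, h4⟩)⟩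
          · rintro (h3 | ⟨c, hc, h3⟩)
            · cases h3
            · have h4 := Finset.mem_sigma.1 (Finset.inr_mem_disjSum.1 h3)
              exact ⟨⟨c, hc, h4.1⟩, h4.2⟩
      · ext ⟨y', z⟩
        rw [Finset.mem_sigma, Finset.mem_biUnion, Finset.mem_biUnion]
        constructor
        · rintro ⟨⟨c, hc, h3⟩, h4⟩
          exact ⟨c, hc, Finset.mem_sigma.2 ⟨h3, h4⟩⟩
        · rintro ⟨c, hc, h3⟩
          exact ⟨⟨c, hc, (Finset.mem_sigma.1 h3).1⟩, (Finset.mem_sigma.1 h3).2⟩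
    · exact fun c hc hm => hx c hc (Finset.inl_mem_disjSum.1 hm)
    · intro c hc d hd hcd
      refine Finset.disjoint_left.2 ?_
      rintro (a | ⟨y', x'⟩) h3 h4
      · exact Finset.disjoint_left.1 (hA hc hd hcd) (Finset.inl_mem_disjSum.1 h3)
          (Finset.inl_mem_disjSum.1 h4)
      · exact Finset.disjoint_left.1 (hB hc hd hcd)
          (Finset.mem_sigma.1 (Finset.inr_mem_disjSum.1 h3)).1
          (Finset.mem_sigma.1 (Finset.inr_mem_disjSum.1 h4)).1
    · intro c hc d hd hcd
      refine Finset.disjoint_left.2 ?_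
      rintro ⟨y', z⟩ h3 h4
      exact Finset.disjoint_left.1 (hB hc hd hcd) (Finset.mem_sigma.1 h3).1
        (Finset.mem_sigma.1 h4).1
    · refine fun c hc => ih c hc _ fun x' c' hm => ?_
      rcases hm with hm | hm
      · cases hm
        exact Or.inl rfl
      · exact Or.inr (h1 _ _ hm)

theorem Tree.compose_univ (hι : ∀ y z, ι y z ∈ F.vars y)
    (hT' : ∀ y, ∃ A, (T y).Tree k ∅ A Finset.univ) (hT : ∃ A, F.Tree k ∅ A Finset.univ) :
    ∃ A, (F.compose T ι).Tree k ∅ A Finset.univ := by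
  choose A' hT' using hT'
  obtain ⟨A, hT⟩ := hT
  exact ⟨_, hT.compose hι hT' ∅ (by simp)⟩

/-- Either some copy of `T y` contains a subgraph with at most one deficient clause, and its own
sparsity applies, or every copy that is met is left through at least two clauses. In the latter case
contracting the copies gives a subgraph of minimum degree two in F; its m clauses become m+1 because
a copy contains two clauses. -/
theorem Sparse.compose {m : ℕ} (hF : F.Sparse m) (hT : ∀ y, (T y).Sparse (m + 1))
    (hι : ∀ y z, ι y z ∈ F.vars y) (hinj : ∀ y, Function.Injective (ι y)) :
    (F.compose T ι).Sparse (m + 1) := by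
  classical
  intro E hne hv hX hY
  -- the part of `E` inside the copy of `T y`
  let R : ∀ y, Finset ((T y).X × (T y).Y) := fun y =>
    E.preimage (fun p => (Sum.inr ⟨y, p.1⟩, ⟨y, p.2⟩)) (by
      rintro ⟨x, z⟩ - ⟨x', z'⟩ - h
      cases h
      rfl)
  have hR : ∀ y x z, (x, z) ∈ R y ↔ (Sum.inr ⟨y, x⟩, ⟨y, z⟩) ∈ E := fun y x z =>
    Finset.mem_preimage
  by_cases hc : ∃ y, (R y).Nonempty ∧ ∃ z₀, ∀ x z, (x, z) ∈ R y → z ≠ z₀ →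
      ∃ x', x' ≠ x ∧ (x', z) ∈ R y
  · obtain ⟨y, hne', z₀, hz₀⟩ := hc
    have h1 := ((hT y).le_card_of_exceptional _ (R y) rfl hne' (fun x z hxz =>
      inr_mem_compose_vars_self.1 (hv _ _ ((hR _ _ _).1 hxz)))).1 (fun x z hxz => by
        obtain ⟨⟨y', z'⟩, h2, h3⟩ := hX _ _ ((hR _ _ _).1 hxz)
        obtain rfl := fst_eq_of_inr_mem_compose_vars (hv _ _ h3)
        exact ⟨z', fun h => h2 (by rw [h]), (hR _ _ _).2 h3⟩) z₀ hz₀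
    refine h1.trans ?_
    rw [← Finset.card_image_of_injective ((R y).image Prod.snd)
      (sigma_mk_injective (i := y) (β := fun y => (T y).Y))]
    refine Finset.card_le_card ?_
    intro w hw
    obtain ⟨z, hz, rfl⟩ := Finset.mem_image.1 hw
    obtain ⟨⟨x, z⟩, hxz, rfl⟩ := Finset.mem_image.1 hz
    exact Finset.mem_image.2 ⟨_, (hR _ _ _).1 hxz, rfl⟩
  · push Not at hc
    have hne' : ∀ p y z, (p, ⟨y, z⟩) ∈ E → (R y).Nonempty := by
      have key : ∀ y x z, (Sum.inr x, ⟨y, z⟩) ∈ E → (R y).Nonempty := by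
        rintro y ⟨y', x⟩ z h
        obtain rfl := fst_eq_of_inr_mem_compose_vars (hv _ _ h)
        exact ⟨(x, z), (hR _ _ _).2 h⟩
      rintro (a | x) y z h
      · obtain ⟨(b | x), h1, h2⟩ := hY _ _ h
        · refine absurd ?_ h1
          rw [inl_mem_compose_vars.1 (hv _ _ h), inl_mem_compose_vars.1 (hv _ _ h2)]
        · exact key y x z h2
      · exact key y x z h
    -- Some clause other than `z₀` has a single edge inside the copy; its second edge in E must be
    -- the added one.
    have hout : ∀ y, (R y).Nonempty → ∀ z₀, ∃ z, z ≠ z₀ ∧ (Sum.inl (ι y z), ⟨y, z⟩) ∈ E := by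
      intro y hy z₀
      obtain ⟨x, z, hxz, hz, h1⟩ := hc y hy z₀
      obtain ⟨(a | ⟨y', x'⟩), h2, h3⟩ := hY _ _ ((hR _ _ _).1 hxz)
      · obtain rfl := inl_mem_compose_vars.1 (hv _ _ h3)
        exact ⟨z, hz, h3⟩
      · obtain rfl := fst_eq_of_inr_mem_compose_vars (hv _ _ h3)
        exact absurd ((hR _ _ _).2 h3) (h1 x' fun h => h2 (by rw [h]))
    let D : Finset (F.X × F.Y) :=
      E.biUnion fun p => Sum.elim (fun a => {(a, p.2.1)}) (fun _ => ∅) p.1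
    have hD : ∀ a y, (a, y) ∈ D ↔ ∃ z, (Sum.inl a, ⟨y, z⟩) ∈ E := by
      intro a y
      simp only [D, Finset.mem_biUnion]
      constructor
      · rintro ⟨⟨(b | x), ⟨y', z⟩⟩, h1, h2⟩
        · cases Finset.mem_singleton.1 h2
          exact ⟨z, h1⟩
        · simp at h2
      · rintro ⟨z, h⟩
        exact ⟨_, h, Finset.mem_singleton_self _⟩
    have hDne : D.Nonempty := by
      obtain ⟨⟨p, ⟨y, z⟩⟩, h⟩ := hne
      obtain ⟨z', -, h'⟩ := hout y (hne' _ _ _ h) z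
      exact ⟨_, (hD _ _).2 ⟨z', h'⟩⟩
    have hm : m ≤ (D.image Prod.snd).card := by
      refine hF D hDne ?_ ?_ ?_
      · intro a y h
        obtain ⟨z, h⟩ := (hD _ _).1 h
        rw [inl_mem_compose_vars.1 (hv _ _ h)]
        exact hι y z
      · intro a y h
        obtain ⟨z, h⟩ := (hD _ _).1 h
        obtain ⟨⟨y', z'⟩, h1, h2⟩ := hX _ _ h
        refine ⟨y', ?_, (hD _ _).2 ⟨z', h2⟩⟩
        rintro rfl
        refine h1 ?_
        rw [hinj y' ((inl_mem_compose_vars.1 (hv _ _ h)).symm.trans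
          (inl_mem_compose_vars.1 (hv _ _ h2)))]
      · intro a y h
        obtain ⟨z, h⟩ := (hD _ _).1 h
        obtain ⟨z', h1, h2⟩ := hout y (hne' _ _ _ h) z
        refine ⟨ι y z', ?_, (hD _ _).2 ⟨z', h2⟩⟩
        rw [inl_mem_compose_vars.1 (hv _ _ h)]
        exact fun h3 => h1 (hinj y h3)
    -- One clause per contracted copy, always avoiding a fixed ⟨y, z⟩, leaves ⟨y, z⟩ as the extra
    -- one.
    obtain ⟨⟨a, y⟩, hay⟩ := hDne
    obtain ⟨z, hz⟩ := (hD _ _).1 hay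
    have hne'' := hne' _ _ _ hz
    have hex : ∀ y', ∃ w : (F.compose T ι).Y, y' ∈ D.image Prod.snd →
        w.1 = y' ∧ w ≠ ⟨y, z⟩ ∧ w ∈ E.image Prod.snd := by
      intro y'
      by_cases hy' : y' ∈ D.image Prod.snd
      · obtain ⟨⟨a', y'⟩, h1, rfl⟩ := Finset.mem_image.1 hy'
        by_cases hyy : y' = y
        · subst hyy
          obtain ⟨z', h2, h3⟩ := hout y' hne'' z
          exact ⟨⟨y', z'⟩, fun _ => ⟨rfl, fun h => h2 (by cases h; rfl),
            Finset.mem_image.2 ⟨_, h3, rfl⟩⟩⟩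
        · obtain ⟨z', h2⟩ := (hD _ _).1 h1
          exact ⟨⟨y', z'⟩, fun _ => ⟨rfl, fun h => hyy (by cases h; rfl),
            Finset.mem_image.2 ⟨_, h2, rfl⟩⟩⟩
      · exact ⟨⟨y, z⟩, fun h => absurd h hy'⟩
    choose w hw using hex
    have h1 : ((D.image Prod.snd).image w).card = (D.image Prod.snd).card :=
      Finset.card_image_of_injOn fun p hp q hq hpq => by
        rw [← (hw p hp).1, ← (hw q hq).1, hpq]
    refine (Nat.succ_le_succ (hm.trans h1.ge)).trans ?_
    have h2 : (⟨y, z⟩ : (F.compose T ι).Y) ∉ (D.image Prod.snd).image w := by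
      intro h
      obtain ⟨p, hp, h⟩ := Finset.mem_image.1 h
      exact (hw p hp).2.1 h
    refine (Finset.card_insert_of_notMem h2).ge.trans ?_
    refine Finset.card_le_card (Finset.insert_subset (Finset.mem_image.2 ⟨_, hz, rfl⟩) ?_)
    intro v hv'
    obtain ⟨p, hp, rfl⟩ := Finset.mem_image.1 hv'
    exact (hw p hp).2.2

end compose

/-! ### Uniform and rainbow systems -/

/-- The system without variables and with one empty clause. -/
abbrev trivialSystem : ClauseSystem where
  X := Empty
  Y := Unit
  decX := inferInstance
  decY := inferInstance
  finY := inferInstance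
  vars _ := ∅
  val _ _ := 0
  list _ := ∅

theorem trivialSystem_tree (k : ℕ) : ∃ A, trivialSystem.Tree k ∅ A Finset.univ :=
  ⟨∅, .leaf (F := trivialSystem) ∅ () (by simp)⟩

theorem trivialSystem_sparse (m : ℕ) : trivialSystem.Sparse m := by
  rintro E ⟨⟨x, -⟩, -⟩
  exact x.elim

/-- The system with one variable, forbidding each of the values in `S`. -/
abbrev star (S : Finset ℕ) : ClauseSystem where
  X := Unit
  Y := S
  decX := inferInstance
  decY := inferInstance
  finY := inferInstance
  vars _ := {()}
  val y _ := y
  list _ := S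

theorem star_tree (S : Finset ℕ) : ∃ A, (star S).Tree S.card ∅ A Finset.univ := by
  have h : (star S).Tree S.card ∅ _ _ := .node (F := star S) ∅ () (fun _ => ∅)
    (fun c => if h : c ∈ S then {⟨c, h⟩} else ∅) rfl (by simp)
    (by simp [Set.PairwiseDisjoint, Set.Pairwise]) ?_ ?_
  · refine ⟨_, h.congr rfl ?_⟩
    ext ⟨y, hy⟩
    simp only [Finset.mem_univ, Finset.mem_biUnion, true_iff]
    refine ⟨y, hy, ?_⟩
    rw [dif_pos hy]
    exact Finset.mem_singleton_self _
  · intro c hc d hd hcd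
    have hc' : c ∈ S := hc
    have hd' : d ∈ S := hd
    simp only [Function.onFun, dif_pos hc', dif_pos hd']
    refine Finset.disjoint_singleton.2 fun h => hcd (congrArg Subtype.val h)
  · intro c hc
    have hc' : c ∈ S := hc
    simp only [dif_pos hc']
    exact .leaf (F := star S) _ ⟨c, hc'⟩ (by simp)

theorem sparse_zero (F : ClauseSystem) : F.Sparse 0 := fun _ _ _ _ _ => Nat.zero_le _

/-- Over a fixed list of values, there are decision trees whose clauses have any prescribed size
and whose incidence graph has any prescribed girth. -/
theorem exists_uniform (S : Finset ℕ) (m : ℕ) : ∀ n : ℕ, ∃ F : ClauseSystem,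
    (∃ A, F.Tree S.card ∅ A Finset.univ) ∧ F.Sparse m ∧ (∀ y, (F.vars y).card = n) ∧
    (∀ x, F.list x = S) ∧ ∀ y, ∀ x ∈ F.vars y, F.val y x ∈ S := by
  induction m with
  | zero =>
    intro n
    induction n with
    | zero => exact ⟨trivialSystem, trivialSystem_tree _, trivialSystem_sparse _, by simp,
        fun x => x.elim, by simp⟩
    | succ n ih =>
      obtain ⟨F, hT, -, hc, hl, hv⟩ := ih
      -- With no girth demand, all added links may go to a single new variable.
      refine ⟨(star S).compose (fun _ => F) fun _ _ => (),
        Tree.compose_univ (by simp) (fun _ => hT) (star_tree S), sparse_zero _, ?_, ?_, ?_⟩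
      · rintro ⟨y, z⟩
        rw [card_compose_vars, hc]
      · rintro (a | ⟨y, x⟩)
        · rfl
        · exact hl x
      · rintro ⟨y, z⟩
        refine forall_mem_compose_vars.2 ⟨y.2, fun x hx => ?_⟩
        rw [compose_val_inr (ι := fun _ _ => ())]
        exact hv z x hx
  | succ m ihm =>
    intro n
    induction n with
    | zero => exact ⟨trivialSystem, trivialSystem_tree _, trivialSystem_sparse _, by simp,
        fun x => x.elim, by simp⟩
    | succ n ih =>
      obtain ⟨F, hT, hs, hc, hl, hv⟩ := ih
      -- Outer clauses have as many variables as F has clauses, so the links can be bijective.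
      obtain ⟨G, hT', hs', hc', hl', hv'⟩ := ihm (Fintype.card F.Y)
      have e : ∀ y, Nonempty (F.Y ≃ G.vars y) := fun y =>
        ⟨Fintype.equivOfCardEq (by rw [Fintype.card_coe, hc'])⟩
      let ι : ∀ y, F.Y → G.X := fun y z => ((e y).some z : G.X)
      have hι : ∀ y z, ι y z ∈ G.vars y := fun y z => ((e y).some z).2
      refine ⟨G.compose (fun _ => F) ι, Tree.compose_univ hι (fun _ => hT) hT',
        hs'.compose (fun _ => hs) hι
          (fun y => Subtype.val_injective.comp (e y).some.injective), ?_, ?_, ?_⟩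
      · rintro ⟨y, z⟩
        rw [card_compose_vars, hc]
      · rintro (a | ⟨y, x⟩)
        · exact hl' a
        · exact hl x
      · rintro ⟨y, z⟩
        refine forall_mem_compose_vars.2 ⟨hv' y _ (hι y z), fun x hx => ?_⟩
        rw [compose_val_inr (ι := ι)]
        exact hv z x hx

/-- There are decision trees with lists of size `k` from a palette of `k + r - 1` colors, whose
clauses prescribe distinct values for `r` variables, and whose incidence graph has any prescribed
girth. -/
theorem exists_rainbow {k : ℕ} (hk : 1 ≤ k) (m r : ℕ) : ∀ U : Finset ℕ, U.card + 1 = k + r →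
    ∃ F : ClauseSystem, (∃ A, F.Tree k ∅ A Finset.univ) ∧ F.Sparse (m + 1) ∧
    (∀ y, (F.vars y).card = r) ∧ (∀ y, ((F.vars y).image (F.val y)).card = r) ∧
    (∀ x, F.list x ⊆ U) ∧ ∀ y, ∀ x ∈ F.vars y, F.val y x ∈ U := by
  induction r with
  | zero =>
    intro U _
    exact ⟨trivialSystem, trivialSystem_tree _, trivialSystem_sparse _, by simp, by simp,
      fun x => x.elim, by simp⟩
  | succ r ih =>
    intro U hU
    obtain ⟨S, hSU, hS⟩ := Finset.exists_subset_card_eq (show k ≤ U.card by omega)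
    -- Systems avoiding c will be extended by variables of value c, which keeps the values in a
    -- clause distinct.
    have ih' : ∀ c : S, ∃ F : ClauseSystem, (∃ A, F.Tree k ∅ A Finset.univ) ∧ F.Sparse (m + 1) ∧
        (∀ y, (F.vars y).card = r) ∧ (∀ y, ((F.vars y).image (F.val y)).card = r) ∧
        (∀ x, F.list x ⊆ U.erase c) ∧ ∀ y, ∀ x ∈ F.vars y, F.val y x ∈ U.erase c := fun c =>
      ih (U.erase c) (by
        have := Finset.card_erase_add_one (hSU c.2)
        omega)
    choose T hT hs hc hd hl hv using ih'
    -- This size forces, in each clause, a value c prescribed on enough variables to link the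
    -- clauses of `T c` injectively.
    obtain ⟨G, hT', hs', hc', hl', hv'⟩ := exists_uniform S m (k * ∑ c, Fintype.card (T c).Y)
    have hSne : S.Nonempty := Finset.card_pos.1 (by omega)
    have hfib : ∀ y, ∃ c : S, Nonempty
        ((T c).Y ↪ ((G.vars y).filter fun x => G.val y x = (c : ℕ) : Finset G.X)) := by
      intro y
      obtain ⟨c, hcS, hcard⟩ := Finset.exists_le_card_fiber_of_mul_le_card_of_maps_to (hv' y)
        hSne (by rw [hS, hc' y])
      refine ⟨⟨c, hcS⟩, Function.Embedding.nonempty_of_card_le ?_⟩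
      rw [Fintype.card_coe]
      exact (Finset.single_le_sum (f := fun c => Fintype.card (T c).Y)
        (fun _ _ => Nat.zero_le _) (Finset.mem_univ _)).trans hcard
    choose c e using hfib
    let ι : ∀ y, (T (c y)).Y → G.X := fun y z => ((e y).some z : G.X)
    have hι : ∀ y z, ι y z ∈ G.vars y := fun y z => (Finset.mem_filter.1 ((e y).some z).2).1
    have hιc : ∀ y z, G.val y (ι y z) = c y := fun y z =>
      (Finset.mem_filter.1 ((e y).some z).2).2
    refine ⟨G.compose (fun y => T (c y)) ι,
      Tree.compose_univ hι (fun y => hT (c y)) (hS ▸ hT'),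
      hs'.compose (fun y => hs (c y)) hι
        (fun y => Subtype.val_injective.comp (e y).some.injective), ?_, ?_, ?_, ?_⟩
    · rintro ⟨y, z⟩
      rw [card_compose_vars, hc]
    · rintro ⟨y, z⟩
      rw [image_compose_vars, Finset.card_insert_of_notMem, hd]
      intro h
      obtain ⟨x, hx, h⟩ := Finset.mem_image.1 h
      have := hv (c y) z x hx
      rw [h, hιc] at this
      exact absurd rfl (Finset.mem_erase.1 this).1
    · rintro (a | ⟨y, x⟩)
      · exact (hl' a).le.trans hSU
      · exact (hl (c y) x).trans (Finset.erase_subset _ _)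
    · rintro ⟨y, z⟩
      refine forall_mem_compose_vars.2 ⟨hSU (hv' y _ (hι y z)), fun x hx => ?_⟩
      rw [compose_val_inr (ι := ι)]
      exact Finset.mem_of_mem_erase (hv (c y) z x hx)

end ClauseSystem

/-! ### Small palettes and degree sums -/

/-- The palette splits into two parts of at most k-1 colors. Each list meets both parts, so each
side of the bipartition can use its own part. -/
theorem SimpleGraph.IsBipartite.listColorable_of_card_biUnion_lt {V C : Type*} [Fintype V]
    [DecidableEq C] {G : SimpleGraph V} (hG : G.IsBipartite) {L : V → Finset C} {k : ℕ}
    (hL : IsListAssignment k L) (hc : (Finset.univ.biUnion L).card < 2 * k - 1) :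
    G.ListColorable L := by
  obtain ⟨b⟩ := hG
  set U := Finset.univ.biUnion L with hU
  obtain ⟨P, hPU, hP⟩ := Finset.exists_subset_card_eq (min_le_right (k - 1) U.card)
  have hLU : ∀ v, L v ⊆ U := fun v => Finset.subset_biUnion_of_mem L (Finset.mem_univ v)
  have h1 : ∀ v, ∃ c ∈ L v, c ∉ P := by
    intro v
    by_contra! h
    have := Finset.card_le_card (show L v ⊆ P from h)
    rw [hL v] at this
    omega
  have h2 : ∀ v, ∃ c ∈ L v, c ∈ P := by
    intro v
    by_contra! h
    have := Finset.card_le_card (show L v ⊆ U \ P from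
      fun c hcv => Finset.mem_sdiff.2 ⟨hLU v hcv, h c hcv⟩)
    rw [hL v, Finset.card_sdiff_of_subset hPU] at this
    omega
  choose p hp hp' using h1
  choose q hq hq' using h2
  refine ⟨⟨fun v => if b v = 0 then p v else q v, ?_⟩, ?_⟩
  · intro u v huv heq
    have hb := b.valid huv
    split_ifs at heq with hu hv hv
    · exact hb (hu.trans hv.symm)
    · exact hp' u (heq ▸ hq' v)
    · exact hp' v (heq ▸ hq' u)
    · omega
  · intro v
    change (if b v = 0 then p v else q v) ∈ L v
    split_ifs
    · exact hp v
    · exact hq v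

open scoped Classical in
theorem SimpleGraph.Subgraph.sum_degree_verts {V : Type*} [Fintype V] {G : SimpleGraph V}
    (H : G.Subgraph) :
    ∑ v : H.verts, H.degree (v : V) = ∑ v, ∑ u, if H.Adj v u then 1 else 0 := by
  have hd : ∀ v [Fintype (H.neighborSet v)],
      H.degree v = ∑ u, if H.Adj v u then 1 else 0 := by
    intro v _
    rw [← Finset.card_filter, SimpleGraph.Subgraph.degree, ← Set.toFinset_card]
    congr 1
    ext u
    simp
  simp only [hd]
  rw [← Finset.sum_subtype (Finset.univ.filter (· ∈ H.verts)) (by simp)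
    fun v => ∑ u, if H.Adj v u then 1 else 0]
  refine Finset.sum_subset (Finset.subset_univ _) fun v _ hv => ?_
  replace hv : v ∉ H.verts := by simpa using hv
  exact Finset.sum_eq_zero fun u _ => if_neg fun h => hv (H.edge_vert h)

/-! ### The incidence graph -/

namespace ClauseSystem

/-- The incidence graph between the variables in `A` and the clauses in `B`. -/
def incidenceGraph (F : ClauseSystem) (A : Finset F.X) (B : Finset F.Y) :
    SimpleGraph (A ⊕ B) where
  Adj := Sum.elim (fun x => Sum.elim (fun _ => False) fun y => (x : F.X) ∈ F.vars y)
    fun y => Sum.elim (fun x => (x : F.X) ∈ F.vars y) fun _ => False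
  symm := ⟨by rintro (x | y) (x' | y') h <;> exact h⟩
  loopless := ⟨by rintro (x | y) h <;> exact h⟩

/-- The lists of the variables, together with the sets of values prescribed by the clauses. -/
def lists (F : ClauseSystem) (A : Finset F.X) (B : Finset F.Y) : A ⊕ B → Finset ℕ :=
  Sum.elim (fun x => F.list x) fun y => (F.vars y).image (F.val y)

variable {F : ClauseSystem} {A : Finset F.X} {B : Finset F.Y} {k : ℕ}

theorem incidenceGraph_adj_inl_inr {x : A} {y : B} :
    (F.incidenceGraph A B).Adj (Sum.inl x) (Sum.inr y) ↔ (x : F.X) ∈ F.vars y := Iff.rfl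

theorem incidenceGraph_not_adj_inl {x x' : A} :
    ¬ (F.incidenceGraph A B).Adj (Sum.inl x) (Sum.inl x') := fun h => h

theorem incidenceGraph_not_adj_inr {y y' : B} :
    ¬ (F.incidenceGraph A B).Adj (Sum.inr y) (Sum.inr y') := fun h => h

theorem isBipartite_incidenceGraph : (F.incidenceGraph A B).IsBipartite := by
  refine ⟨⟨Sum.elim (fun _ => 0) fun _ => 1, ?_⟩⟩
  rintro (x | y) (x' | y') h
  · exact absurd h incidenceGraph_not_adj_inl
  · simp
  · simp
  · exact absurd h incidenceGraph_not_adj_inr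

/-- The edges of a cycle have minimum degree two, and each clause on it accounts for at least two of
them. -/
theorem Sparse.le_egirth {m : ℕ} (hF : F.Sparse m) :
    ((2 * m : ℕ) : ℕ∞) ≤ (F.incidenceGraph A B).egirth := by
  classical
  rw [SimpleGraph.le_egirth]
  intro v w hw
  rw [Nat.cast_le]
  have hdeg : ∀ u t, w.toSubgraph.Adj u t → ∃ t', t' ≠ t ∧ w.toSubgraph.Adj u t' := by
    intro u t h
    have h2 := hw.ncard_neighborSet_toSubgraph_eq_two
      ((SimpleGraph.Walk.mem_verts_toSubgraph w).1 (w.toSubgraph.edge_vert h))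
    obtain ⟨t', h3, h4⟩ := Set.exists_ne_of_one_lt_ncard (by rw [h2]; norm_num) t
    exact ⟨t', h4, h3⟩
  let E' : Finset (A × B) :=
    Finset.univ.filter fun p => w.toSubgraph.Adj (Sum.inl p.1) (Sum.inr p.2)
  let E : Finset (F.X × F.Y) := E'.image fun p => ((p.1 : F.X), (p.2 : F.Y))
  have hE : ∀ x y, (x, y) ∈ E ↔
      ∃ x' : A, ∃ y' : B, w.toSubgraph.Adj (Sum.inl x') (Sum.inr y') ∧ x' = x ∧ y' = y := by
    intro x y
    simp [E, E']
  have hX : ∀ x y, (x, y) ∈ E → ∃ y', y' ≠ y ∧ (x, y') ∈ E := by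
    intro x y hxy
    obtain ⟨x, y, h, rfl, rfl⟩ := (hE _ _).1 hxy
    obtain ⟨(x' | y'), h1, h2⟩ := hdeg _ _ h
    · exact absurd h2.adj_sub incidenceGraph_not_adj_inl
    · exact ⟨y', fun h3 => h1 (by rw [Subtype.ext h3]), (hE _ _).2 ⟨x, y', h2, rfl, rfl⟩⟩
  have hY : ∀ x y, (x, y) ∈ E → ∃ x', x' ≠ x ∧ (x', y) ∈ E := by
    intro x y hxy
    obtain ⟨x, y, h, rfl, rfl⟩ := (hE _ _).1 hxy
    obtain ⟨(x' | y'), h1, h2⟩ := hdeg _ _ h.symm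
    · exact ⟨x', fun h3 => h1 (by rw [Subtype.ext h3]), (hE _ _).2 ⟨x', y, h2.symm, rfl, rfl⟩⟩
    · exact absurd h2.adj_sub incidenceGraph_not_adj_inr
  have hne : E.Nonempty := by
    have h2 := hw.ncard_neighborSet_toSubgraph_eq_two w.start_mem_support
    obtain ⟨t, ht⟩ := Set.nonempty_of_ncard_ne_zero (by rw [h2]; norm_num)
    have ht' : w.toSubgraph.Adj v t := ht
    rcases v with x | y <;> rcases t with x' | y'
    · exact absurd ht'.adj_sub incidenceGraph_not_adj_inl
    · exact ⟨_, (hE _ _).2 ⟨x, y', ht', rfl, rfl⟩⟩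
    · exact ⟨_, (hE _ _).2 ⟨x', y, ht'.symm, rfl, rfl⟩⟩
    · exact absurd ht'.adj_sub incidenceGraph_not_adj_inr
  have hm := hF E hne (fun x y hxy => by
    obtain ⟨x, y, h, rfl, rfl⟩ := (hE _ _).1 hxy
    exact h.adj_sub) hX hY
  have h2 : 2 * (E.image Prod.snd).card ≤ E.card := by
    refine Finset.mul_card_image_le_card E 2 fun y hy => ?_
    obtain ⟨⟨x, y⟩, hxy, rfl⟩ := Finset.mem_image.1 hy
    obtain ⟨x', h1, h3⟩ := hY _ _ hxy
    rw [← Finset.card_pair (show (x', y) ≠ (x, y) from fun h => h1 (Prod.mk.inj h).1)]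
    refine Finset.card_le_card ?_
    simp [Finset.insert_subset_iff, hxy, h3]
  have h3 : E.card ≤ w.length := by
    refine Finset.card_image_le.trans ?_
    rw [← SimpleGraph.Walk.length_edges]
    refine le_trans ?_ (List.toFinset_card_le _)
    refine Finset.card_le_card_of_injOn (fun p => s(Sum.inl p.1, Sum.inr p.2)) ?_ ?_
    · intro p hp
      have := (Finset.mem_filter.1 hp).2
      simpa [SimpleGraph.Walk.adj_toSubgraph_iff_mem_edges] using this
    · rintro ⟨x, y⟩ - ⟨x', y'⟩ - h
      simpa using h
  omega

theorem EssentialTree.not_listColorable (hT : F.EssentialTree k ∅ A B) :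
    ¬ (F.incidenceGraph A B).ListColorable (F.lists A B) := by
  rintro ⟨f, hf⟩
  obtain ⟨y, hy, hv⟩ := hT.exists_violated
    (fun x => if h : x ∈ A then f (Sum.inl ⟨x, h⟩) else 0)
    (fun x hx => by rw [dif_pos hx]; exact hf (Sum.inl ⟨x, hx⟩)) (by simp)
  obtain ⟨x, hx, hxy⟩ := Finset.mem_image.1 (show f (Sum.inr ⟨y, hy⟩) ∈ _ from hf _)
  have hxA : x ∈ A := (hT.mem_of_mem_vars y hy x hx).resolve_right (by simp)
  have h1 := hv x hx
  rw [dif_pos hxA, hxy] at h1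
  exact f.valid (incidenceGraph_adj_inl_inr.2 hx) h1

open scoped Classical in
theorem sum_degree_eq (H : (F.incidenceGraph A B).Subgraph) :
    ∑ v : H.verts, H.degree (v : A ⊕ B) =
      2 * ∑ y : B, (Finset.univ.filter fun x : A => H.Adj (Sum.inl x) (Sum.inr y)).card := by
  refine H.sum_degree_verts.trans ?_
  simp only [Fintype.sum_sum_type]
  have h2 : ∀ x x' : A, ¬ H.Adj (Sum.inl x) (Sum.inl x') := fun x x' h =>
    incidenceGraph_not_adj_inl h.adj_sub
  have h3 : ∀ y y' : B, ¬ H.Adj (Sum.inr y) (Sum.inr y') := fun y y' h =>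
    incidenceGraph_not_adj_inr h.adj_sub
  simp only [h2, h3, if_false, Finset.sum_const_zero, zero_add, add_zero, Finset.card_filter]
  rw [Finset.sum_comm, two_mul]
  simp only [H.adj_comm]

open scoped Classical in
theorem card_verts_eq (H : (F.incidenceGraph A B).Subgraph) :
    Fintype.card H.verts = (Finset.univ.filter fun x : A => Sum.inl x ∈ H.verts).card +
      (Finset.univ.filter fun y : B => Sum.inr y ∈ H.verts).card := by
  rw [← Set.toFinset_card]
  have h : H.verts.toFinset = Finset.univ.filter fun v => v ∈ H.verts := by
    ext v
    simp
  rw [h, Finset.card_filter, Finset.card_filter, Finset.card_filter, Fintype.sum_sum_type]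

-- If all variables are present, a full set of clauses would give the whole graph, so at least one
-- clause is not full. Otherwise a full clause avoids the set Z of missing variables, and
-- `card_touching` bounds how many clauses do.
open scoped Classical in
theorem EssentialTree.card_full_le (hk : 1 ≤ k) (hT : F.EssentialTree k ∅ A B)
    (hc : ∀ y, (F.vars y).card = k) (H : (F.incidenceGraph A B).Subgraph) (hH : H ≠ ⊤) :
    (Finset.univ.filter fun y : B =>
      k ≤ (Finset.univ.filter fun x : A => H.Adj (Sum.inl x) (Sum.inr y)).card).card ≤
      (k - 1) * (Finset.univ.filter fun x : A => Sum.inl x ∈ H.verts).card := by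
  set full := Finset.univ.filter fun y : B =>
    k ≤ (Finset.univ.filter fun x : A => H.Adj (Sum.inl x) (Sum.inr y)).card with hfull
  have hadj : ∀ y ∈ full, ∀ x ∈ F.vars y,
      ∃ h : x ∈ A, H.Adj (Sum.inl ⟨x, h⟩) (Sum.inr y) := by
    intro y hy x hx
    have h1 : ((Finset.univ.filter fun x : A => H.Adj (Sum.inl x) (Sum.inr y)).map
        (Function.Embedding.subtype _)) = F.vars y := by
      refine Finset.eq_of_subset_of_card_le ?_ ?_
      · intro x hx
        obtain ⟨x, hx', rfl⟩ := Finset.mem_map.1 hx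
        exact incidenceGraph_adj_inl_inr.1 (Finset.mem_filter.1 hx').2.adj_sub
      · rw [hc, Finset.card_map]
        exact (Finset.mem_filter.1 hy).2
    rw [← h1] at hx
    obtain ⟨x, hx', rfl⟩ := Finset.mem_map.1 hx
    exact ⟨x.2, (Finset.mem_filter.1 hx').2⟩
  have hB := hT.card_leaves hk
  by_cases hP : ∀ x : A, Sum.inl x ∈ H.verts
  · rw [Finset.filter_true_of_mem fun x _ => hP x, Finset.card_univ, Fintype.card_coe]
    have hlt : full.card < Fintype.card B := by
      rw [← Finset.card_univ]
      refine Finset.card_lt_card (Finset.ssubset_univ_iff.2 fun hf => hH ?_)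
      have hadj' : ∀ (x : A) (y : B), (F.incidenceGraph A B).Adj (Sum.inl x) (Sum.inr y) →
          H.Adj (Sum.inl x) (Sum.inr y) := fun x y h =>
        (hadj y (hf ▸ Finset.mem_univ y) x h).2
      have hQ : ∀ y : B, Sum.inr y ∈ H.verts := by
        intro y
        obtain ⟨x, hx⟩ := Finset.card_pos.1 (hk.trans (hc y).ge)
        exact H.edge_vert (hadj y (hf ▸ Finset.mem_univ y) x hx).2.symm
      refine SimpleGraph.Subgraph.ext ?_ ?_
      · refine Set.eq_univ_of_forall ?_
        rintro (x | y)
        · exact hP x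
        · exact hQ y
      · ext (x | y) (x' | y')
        · exact ⟨fun h => h.adj_sub, fun h => absurd h.adj_sub incidenceGraph_not_adj_inl⟩
        · exact ⟨fun h => h.adj_sub, fun h => hadj' x y' h⟩
        · exact ⟨fun h => h.adj_sub, fun h => (hadj' x' y h).symm⟩
        · exact ⟨fun h => h.adj_sub, fun h => absurd h.adj_sub incidenceGraph_not_adj_inr⟩
    rw [Fintype.card_coe] at hlt
    omega
  · push Not at hP
    obtain ⟨x₀, hx₀⟩ := hP
    set Z := (Finset.univ.filter fun x : A => Sum.inl x ∉ H.verts).map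
      (Function.Embedding.subtype _) with hZ
    have hZcard : (Finset.univ.filter fun x : A => Sum.inl x ∈ H.verts).card + Z.card = A.card := by
      rw [hZ, Finset.card_map, Finset.card_filter_add_card_filter_not, Finset.card_univ,
        Fintype.card_coe]
    have h1 := hT.card_touching hk Z
      (by
        intro x hx
        obtain ⟨x, -, rfl⟩ := Finset.mem_map.1 hx
        exact x.2)
      ⟨x₀, Finset.mem_map.2 ⟨x₀, by simpa using hx₀, rfl⟩⟩
    have h2 : (full.map (Function.Embedding.subtype _)).card +
        (B.filter fun y => ∃ z ∈ Z, z ∈ F.vars y).card ≤ B.card := by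
      rw [← Finset.card_union_of_disjoint]
      · refine Finset.card_le_card (Finset.union_subset ?_ (Finset.filter_subset _ _))
        intro y hy
        obtain ⟨y, -, rfl⟩ := Finset.mem_map.1 hy
        exact y.2
      · refine Finset.disjoint_left.2 fun y hy hy' => ?_
        obtain ⟨y, hyf, rfl⟩ := Finset.mem_map.1 hy
        obtain ⟨-, z, hz, hzy⟩ := Finset.mem_filter.1 hy'
        obtain ⟨h3, h4⟩ := hadj y hyf z hzy
        obtain ⟨z, hz', rfl⟩ := Finset.mem_map.1 hz
        exact (Finset.mem_filter.1 hz').2 (H.edge_vert h4)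
    rw [Finset.card_map] at h2
    have h3 := congrArg (fun n => (k - 1) * n) hZcard
    simp only [mul_add] at h3
    omega

theorem EssentialTree.averageDegree_le (hk : 1 ≤ k) (hT : F.EssentialTree k ∅ A B)
    (hc : ∀ y, (F.vars y).card = k) (H : (F.incidenceGraph A B).Subgraph) (hH : H ≠ ⊤) :
    H.averageDegree ≤ 2 * ((k : ℚ) - 1) := by
  classical
  have hk' : (0 : ℚ) ≤ (k : ℚ) - 1 := by
    rw [sub_nonneg]
    exact_mod_cast hk
  -- Each clause present is charged k-1 edges, and a full clause one more.
  have hd : ∀ y : B, (Finset.univ.filter fun x : A => H.Adj (Sum.inl x) (Sum.inr y)).card ≤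
      (k - 1) * (if Sum.inr y ∈ H.verts then 1 else 0) +
      if k ≤ (Finset.univ.filter fun x : A => H.Adj (Sum.inl x) (Sum.inr y)).card then 1 else 0 := by
    intro y
    have h1 : (Finset.univ.filter fun x : A => H.Adj (Sum.inl x) (Sum.inr y)).card ≤ k := by
      rw [← hc y, ← Finset.card_map (Function.Embedding.subtype _)]
      refine Finset.card_le_card fun x hx => ?_
      obtain ⟨x, hx', rfl⟩ := Finset.mem_map.1 hx
      exact incidenceGraph_adj_inl_inr.1 (Finset.mem_filter.1 hx').2.adj_sub
    by_cases hy : Sum.inr y ∈ H.verts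
    · rw [if_pos hy]
      split_ifs <;> omega
    · rw [Finset.filter_false_of_mem fun x _ h => hy (H.edge_vert h.symm)]
      simp
  have hsum := Finset.sum_le_sum fun y (_ : y ∈ Finset.univ) => hd y
  rw [Finset.sum_add_distrib, ← Finset.mul_sum, ← Finset.card_filter, ← Finset.card_filter] at hsum
  have hfull := hT.card_full_le hk hc H hH
  have hmain : ∑ v : H.verts, H.degree (v : A ⊕ B) ≤ 2 * ((k - 1) * Fintype.card H.verts) := by
    rw [sum_degree_eq, card_verts_eq, mul_add]
    refine Nat.mul_le_mul_left 2 (hsum.trans ?_)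
    rw [add_comm]
    exact Nat.add_le_add_right hfull _
  have hmain' : ∑ v : H.verts, (H.degree (v : A ⊕ B) : ℚ) ≤
      2 * ((k : ℚ) - 1) * Fintype.card H.verts := by
    have := (Nat.cast_le (α := ℚ)).2 hmain
    push_cast [Nat.cast_sub hk] at this
    linarith
  unfold SimpleGraph.Subgraph.averageDegree
  -- This form of the division bound also covers the subgraph without vertices.
  refine div_le_of_le_mul₀ (Nat.cast_nonneg _) (by positivity) ?_
  convert hmain'

end ClauseSystem

theorem mainTheorem5 (k g : ℕ) (hk : 2 ≤ k) (hg : Even g) :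
    ∃ (V : Type) (_ : Fintype V) (H : SimpleGraph V) (L : V → Finset ℕ),
      H.IsBipartite ∧
      (g : ℕ∞) ≤ H.egirth ∧
      (∀ F : H.Subgraph, F ≠ ⊤ → F.averageDegree ≤ 2 * ((k : ℚ) - 1)) ∧
      IsListAssignment k L ∧
      (Finset.univ.biUnion L).card = 2 * k - 1 ∧
      ¬ H.ListColorable L := by
  have hk1 : 1 ≤ k := by omega
  obtain ⟨m, rfl⟩ := hg
  -- Taking r = k makes the clause lists have size k and the palette size k + r - 1 = 2k - 1.
  obtain ⟨F, ⟨A₀, hT₀⟩, hs, hc, hd, hl, hv⟩ := ClauseSystem.exists_rainbow hk1 m k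
    (Finset.range (2 * k - 1)) (by rw [Finset.card_range]; omega)
  obtain ⟨A, -, B, -, hT⟩ := hT₀.exists_essentialTree
  have hL : IsListAssignment k (F.lists A B) := by
    rintro (x | y)
    · exact hT.list_card x x.2
    · exact hd y
  refine ⟨A ⊕ B, inferInstance, F.incidenceGraph A B, F.lists A B,
    ClauseSystem.isBipartite_incidenceGraph, ?_, hT.averageDegree_le hk1 hc, hL, ?_,
    hT.not_listColorable⟩
  · rw [← two_mul]
    exact (hs.mono (Nat.le_succ m)).le_egirth
  -- The palette gives the upper bound; fewer colors would make this bipartite graph colorable.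
  · refine le_antisymm ?_ (not_lt.1 fun h => hT.not_listColorable
      (ClauseSystem.isBipartite_incidenceGraph.listColorable_of_card_biUnion_lt hL h))
    refine (Finset.card_le_card (Finset.biUnion_subset.2 ?_)).trans (Finset.card_range _).le
    rintro (x | y) -
    · exact hl x
    · exact Finset.image_subset_iff.2 (hv y)
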